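/- **Conventions.** For a based space $(Y,e)$, let $\mathrm{SP}(Y)$ be the free commutative monoid on $Y$ with unit $e$ (finite formal sums of points of $Y$, with $e=0$), with the quotient topology from $\bigsqcup_n Y^n$. For based spaces, $Y\wedge Z=(Y\times Z)/(Y\vee Z)$. Let $M$ be a manifold (or, more generally, any topological space), let $M_0\subseteq M$, and let $(X,x_0)$ be a based space. Let $C=C(M,M_0;X)$ be the space of finite labelled configurations $\xi_I=\{(m_i,x_i)\}_{i\in I}$ with $m_i\in M$ pairwise distinct and $x_i\in X$, modulo the relation generated by $\xi_I\sim\xi_I\cup\{(m,x)\}$ whenever $m\in M_0$ or $x=x_0$; it has the quotient topology from $\bigsqcup_n F_n(M)\times X^n$, where $F_n(M)\subseteq M^n$ is the space of $n$-tuples of distinct points. For $J\subseteq I$ write $\xi_J=\{(m_i,x_i)\}_{i\in J}$. Let $C_k\subseteq C$ be the subspace of configurations of at most $k$ points, let $D_k=C_k/C_{k-1}$, based at the collapsed point $\infty$, and let $V=\bigvee_{k\ge1}D_k$. Let $$\Phi,\Psi:V\to \mathrm{SP}(V\wedge V),\qquad \Phi(\xi_I)=\sum_{I=A\sqcup B}(\xi_A,\xi_B),\qquad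 \Psi(\xi_I)=\sum_{I=A\cup B}(\xi_A,\xi_B)$$ for $\xi_I\in D_{|I|}$. The first sum runs over the ordered pairs $(A,B)$ of disjoint subsets of $I$ with union $I$, and the second over all ordered pairs $(A,B)$ of subsets of $I$ with union $I$. Here $\xi_A$ is read as a point of $D_{|A|}\subseteq V$, and $\xi_\emptyset$ as the basepoint of $V$. **Proposition.** Suppose that $M_0=\emptyset$ and that $X=S^{2l}$ is a sphere of even dimension $2l$ with $l\ge1$, based at any point $x_0$. Then $\Phi$ and $\Psi$ are continuous based maps, and they are based homotopic. -/

import Mathlib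

noncomputable section

namespace LabelledConf

universe u v

/-! ### Collapsing a subspace, smash products, wedges -/

/-- The quotient space `Y / S`, in which the (nonempty) subset `S` is collapsed to one point. -/
def Collapse (Y : Type u) (S : Set Y) : Type u :=
  Quot fun a b : Y => a ∈ S ∧ b ∈ S

instance (Y : Type u) [TopologicalSpace Y] (S : Set Y) : TopologicalSpace (Collapse Y S) :=
  inferInstanceAs (TopologicalSpace (Quot fun a b : Y => a ∈ S ∧ b ∈ S))

/-- The projection `Y → Y / S`. -/
def Collapse.mk {Y : Type u} (S : Set Y) (y : Y) : Collapse Y S :=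
  Quot.mk _ y

theorem Collapse.sound {Y : Type u} {S : Set Y} {a b : Y} (ha : a ∈ S) (hb : b ∈ S) :
    Collapse.mk S a = Collapse.mk S b :=
  Quot.sound ⟨ha, hb⟩

/-- The subspace `Y ∨ Z` of `Y × Z`. -/
def axes {Y : Type u} {Z : Type v} (y₀ : Y) (z₀ : Z) : Set (Y × Z) :=
  {p | p.1 = y₀ ∨ p.2 = z₀}

/-- The smash product `Y ∧ Z = (Y × Z) / (Y ∨ Z)` of the based spaces `(Y, y₀)` and `(Z, z₀)`. -/
abbrev Smash {Y : Type u} {Z : Type v} (y₀ : Y) (z₀ : Z) : Type (max u v) :=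
  Collapse (Y × Z) (axes y₀ z₀)

/-- The point `(y, z)` of `Y ∧ Z`. -/
def Smash.mk {Y : Type u} {Z : Type v} (y₀ : Y) (z₀ : Z) (y : Y) (z : Z) : Smash y₀ z₀ :=
  Collapse.mk (axes y₀ z₀) (y, z)

/-- The basepoint of `Y ∧ Z`. -/
def Smash.base {Y : Type u} {Z : Type v} (y₀ : Y) (z₀ : Z) : Smash y₀ z₀ :=
  Smash.mk y₀ z₀ y₀ z₀

/-- The wedge of a family of based spaces: their disjoint union with all basepoints identified. -/
abbrev Wedge {ι : Type u} {Y : ι → Type v} (y₀ : ∀ i, Y i) : Type (max u v) :=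
  Collapse (Σ i, Y i) {p | p.2 = y₀ p.1}

/-! ### Symmetric products -/

/-- The symmetric product `SP(Y)` of a based space `(Y, e)`, as a monoid: the free commutative
monoid `Multiset Y` on `Y`, modulo the congruence generated by `e = 0`. -/
def SP {Y : Type u} (e : Y) : Type u :=
  (addConGen fun a b : Multiset Y => a = {e} ∧ b = 0).Quotient

instance {Y : Type u} (e : Y) : AddCommMonoid (SP e) :=
  inferInstanceAs (AddCommMonoid (addConGen fun a b : Multiset Y => a = {e} ∧ b = 0).Quotient)

/-- The inclusion `Y → SP(Y)` of the generators. -/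
def SP.of {Y : Type u} (e : Y) (y : Y) : SP e :=
  (addConGen fun a b : Multiset Y => a = {e} ∧ b = 0).mk' {y}

theorem SP.of_base {Y : Type u} (e : Y) : SP.of e e = 0 :=
  (AddCon.eq _).2 (AddConGen.Rel.of _ _ ⟨rfl, rfl⟩)

/-- The surjection `⨆ₙ Yⁿ → SP(Y)`, `(y₁, …, yₙ) ↦ y₁ + ⋯ + yₙ`. -/
def SP.sum {Y : Type u} (e : Y) (t : Σ n : ℕ, (Fin n → Y)) : SP e :=
  ∑ i, SP.of e (t.2 i)

/-- `SP(Y)` carries the quotient topology from the disjoint union of the powers `Yⁿ`. -/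
instance {Y : Type u} [TopologicalSpace Y] (e : Y) : TopologicalSpace (SP e) :=
  TopologicalSpace.coinduced (SP.sum e) inferInstance

/-! ### Labelled configuration spaces -/

/-- Ordered configurations of `n` distinct points of `M` with labels in `X`, topologised as a
subspace of `(M × X)ⁿ`. -/
abbrev OrdConf (M : Type u) (X : Type v) (n : ℕ) : Type (max u v) :=
  {c : Fin n → M × X // Function.Injective fun i => (c i).1}

section

variable {M : Type u} {X : Type v}

/-- Reindexing a configuration, or restricting it to some of its points. -/
def OrdConf.comp {m n : ℕ} (c : OrdConf M X n) (f : Fin m ↪ Fin n) : OrdConf M X m :=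
  ⟨fun i => c.1 (f i), c.2.comp f.injective⟩

/-- The sub-configuration `ξ_A` of `ξ` consisting of the points with index in `A`. -/
def OrdConf.restrict {n : ℕ} (c : OrdConf M X n) (A : Finset (Fin n)) : OrdConf M X A.card :=
  c.comp (A.orderEmbOfFin rfl).toEmbedding

/-- A labelled point `(m, x)` vanishes if `m ∈ M₀` or `x = x₀`. -/
def Vanishing (M₀ : Set M) (x₀ : X) (p : M × X) : Prop :=
  p.1 ∈ M₀ ∨ p.2 = x₀

/-- The relation generating the identifications in `C(M, M₀; X)`: the order of the points is
forgotten, and a vanishing point may be added or removed. -/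
inductive ConfRel (M₀ : Set M) (x₀ : X) :
    (Σ n, OrdConf M X n) → (Σ n, OrdConf M X n) → Prop
  | perm {n : ℕ} (c : OrdConf M X n) (σ : Equiv.Perm (Fin n)) :
      ConfRel M₀ x₀ ⟨n, c.comp σ.toEmbedding⟩ ⟨n, c⟩
  | add {n : ℕ} (c : OrdConf M X (n + 1)) (h : Vanishing M₀ x₀ (c.1 (Fin.last n))) :
      ConfRel M₀ x₀ ⟨n, c.comp Fin.castSuccEmb⟩ ⟨n + 1, c⟩

/-- The labelled configuration space `C(M, M₀; X)`. -/
def Conf (M₀ : Set M) (x₀ : X) : Type (max u v) :=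
  Quot (ConfRel M₀ x₀)

instance [TopologicalSpace M] [TopologicalSpace X] (M₀ : Set M) (x₀ : X) :
    TopologicalSpace (Conf M₀ x₀) :=
  inferInstanceAs (TopologicalSpace (Quot (ConfRel M₀ x₀)))

/-- The class in `C(M, M₀; X)` of an ordered labelled configuration. -/
def Conf.mk (M₀ : Set M) (x₀ : X) {n : ℕ} (c : OrdConf M X n) : Conf M₀ x₀ :=
  Quot.mk _ ⟨n, c⟩

/-- The filtration stage `C_k`: the configurations of at most `k` points. -/
def Conf.stage (M₀ : Set M) (x₀ : X) (k : ℕ) : Set (Conf M₀ x₀) :=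
  {ξ | ∃ n ≤ k, ∃ c : OrdConf M X n, Conf.mk M₀ x₀ c = ξ}

/-- The empty configuration. -/
def Conf.empty (M₀ : Set M) (x₀ : X) : Conf M₀ x₀ :=
  Conf.mk M₀ x₀ (n := 0) ⟨fun i => i.elim0, fun i => i.elim0⟩

theorem Conf.empty_mem_stage (M₀ : Set M) (x₀ : X) (k : ℕ) :
    Conf.empty M₀ x₀ ∈ Conf.stage M₀ x₀ k :=
  ⟨0, k.zero_le, _, rfl⟩

/-- The part of `C_k` coming from lower filtration; it is `C_{k-1}` when `k ≥ 1`. -/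
def Conf.lower (M₀ : Set M) (x₀ : X) (k : ℕ) : Set (Conf.stage M₀ x₀ k) :=
  {ξ | ∃ j < k, ξ.1 ∈ Conf.stage M₀ x₀ j}

/-- The filtration quotient `D_k = C_k / C_{k-1}`. -/
abbrev D (M₀ : Set M) (x₀ : X) (k : ℕ) : Type (max u v) :=
  Collapse (Conf.stage M₀ x₀ k) (Conf.lower M₀ x₀ k)

/-- The basepoint `∞` of `D_k`, to which `C_{k-1}` is collapsed. -/
def D.base (M₀ : Set M) (x₀ : X) (k : ℕ) : D M₀ x₀ k :=
  Collapse.mk _ ⟨Conf.empty M₀ x₀, Conf.empty_mem_stage M₀ x₀ k⟩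

/-- The class in `D_k` of a configuration of `k` points. -/
def D.mk (M₀ : Set M) (x₀ : X) {k : ℕ} (c : OrdConf M X k) : D M₀ x₀ k :=
  Collapse.mk _ ⟨Conf.mk M₀ x₀ c, k, le_rfl, c, rfl⟩

/-- The wedge `V = ⋁_{k ≥ 1} D_k`. -/
abbrev V (M₀ : Set M) (x₀ : X) : Type (max u v) :=
  Wedge fun k : {k : ℕ // 0 < k} => D.base M₀ x₀ k.1

/-- The inclusion `D_k → V`. -/
def V.incl (M₀ : Set M) (x₀ : X) (k : {k : ℕ // 0 < k}) (d : D M₀ x₀ k.1) : V M₀ x₀ :=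
  Collapse.mk _ ⟨k, d⟩

/-- The basepoint of `V`. -/
def V.base (M₀ : Set M) (x₀ : X) : V M₀ x₀ :=
  V.incl M₀ x₀ ⟨1, one_pos⟩ (D.base M₀ x₀ 1)

/-- A configuration of `n` points regarded as a point of `D_n ⊆ V`; the empty configuration is the
basepoint of `V`. -/
def V.mk (M₀ : Set M) (x₀ : X) {n : ℕ} (c : OrdConf M X n) : V M₀ x₀ :=
  if h : 0 < n then V.incl M₀ x₀ ⟨n, h⟩ (D.mk M₀ x₀ c) else V.base M₀ x₀

/-- The symmetric product `SP(V ∧ V)`. -/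
abbrev SPVV (M₀ : Set M) (x₀ : X) : Type (max u v) :=
  SP (Smash.base (V.base M₀ x₀) (V.base M₀ x₀))

/-- The element `(ξ_A, ξ_B)` of `SP(V ∧ V)`. -/
def pairTerm (M₀ : Set M) (x₀ : X) {n : ℕ} (c : OrdConf M X n)
    (P : Finset (Fin n) × Finset (Fin n)) : SPVV M₀ x₀ :=
  SP.of _ (Smash.mk _ _ (V.mk M₀ x₀ (c.restrict P.1)) (V.mk M₀ x₀ (c.restrict P.2)))

/-! ### The maps `Φ` and `Ψ` -/

/-- The map `Φ` on representatives of points of `D_k`. When `ξ` has exactly `k` points this is the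
sum of the `(ξ_A, ξ_B)` over all decompositions of the index set into disjoint `A` and `B`. When
`ξ` has `n > k` points, at least `n - k` of which vanish, the terms containing a vanishing point are
zero, so this is the same sum for `ξ` with `n - k` vanishing points removed. -/
def splitSum (M₀ : Set M) (x₀ : X) (k : ℕ) (ξ : Σ n, OrdConf M X n) : SPVV M₀ x₀ :=
  ∑ P : Finset (Fin ξ.1) × Finset (Fin ξ.1) with (P.1 ∪ P.2).card = k ∧ Disjoint P.1 P.2,
    pairTerm M₀ x₀ ξ.2 P

/-- The map `Ψ` on representatives of points of `D_k`: as for `splitSum`, except that `A` and `B`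
need not be disjoint. -/
def coverSum (M₀ : Set M) (x₀ : X) (k : ℕ) (ξ : Σ n, OrdConf M X n) : SPVV M₀ x₀ :=
  ∑ P : Finset (Fin ξ.1) × Finset (Fin ξ.1) with (P.1 ∪ P.2).card = k,
    pairTerm M₀ x₀ ξ.2 P

/-! Well-definedness of `Φ` and `Ψ`. -/

theorem V.incl_base (M₀ : Set M) (x₀ : X) (k : {k : ℕ // 0 < k}) :
    V.incl M₀ x₀ k (D.base M₀ x₀ k.1) = V.base M₀ x₀ :=
  Collapse.sound rfl rfl

theorem Conf.mk_perm (M₀ : Set M) (x₀ : X) {n : ℕ} (c : OrdConf M X n)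
    (σ : Equiv.Perm (Fin n)) : Conf.mk M₀ x₀ (c.comp σ.toEmbedding) = Conf.mk M₀ x₀ c :=
  Quot.sound (ConfRel.perm c σ)

theorem V.mk_congr (M₀ : Set M) (x₀ : X) {n : ℕ} {c c' : OrdConf M X n}
    (h : Conf.mk M₀ x₀ c = Conf.mk M₀ x₀ c') : V.mk M₀ x₀ c = V.mk M₀ x₀ c' := by
  have : D.mk M₀ x₀ c = D.mk M₀ x₀ c' := by
    unfold D.mk
    congr 1
    exact Subtype.ext h
  unfold V.mk
  by_cases hn : 0 < n
  · rw [dif_pos hn, dif_pos hn]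
    exact congrArg (V.incl M₀ x₀ ⟨n, hn⟩) this
  · rw [dif_neg hn, dif_neg hn]

theorem V.mk_comp_eq (M₀ : Set M) (x₀ : X) {a b n : ℕ} (c : OrdConf M X n)
    (f : Fin a ↪ Fin n) (g : Fin b ↪ Fin n) (h : Set.range f = Set.range g) :
    V.mk M₀ x₀ (c.comp f) = V.mk M₀ x₀ (c.comp g) := by
  have hab : a = b := by
    have h1 := Set.card_range_of_injective f.injective
    have h2 := Set.card_range_of_injective g.injective
    have h3 : Fintype.card (Set.range f) = Fintype.card (Set.range g) := by
      simp only [← Nat.card_eq_fintype_card, h]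
    simpa [h1, h2] using h3
  subst hab
  let σ : Equiv.Perm (Fin a) :=
    (Equiv.ofInjective f f.injective).trans
      ((Equiv.setCongr h).trans (Equiv.ofInjective g g.injective).symm)
  have hσ : ∀ i, g (σ i) = f i := fun i => by
    have := Equiv.apply_ofInjective_symm g.injective
      (Equiv.setCongr h (Equiv.ofInjective f f.injective i))
    exact this
  have hc : c.comp f = (c.comp g).comp σ.toEmbedding := by
    apply Subtype.ext
    funext i
    exact congrArg c.1 (hσ i).symm
  rw [hc]
  exact V.mk_congr M₀ x₀ (Conf.mk_perm M₀ x₀ _ σ)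

theorem V.mk_eq_base (M₀ : Set M) (x₀ : X) {n : ℕ} (c : OrdConf M X n) (i : Fin n)
    (hi : Vanishing M₀ x₀ (c.1 i)) : V.mk M₀ x₀ c = V.base M₀ x₀ := by
  obtain _ | n := n
  · exact i.elim0
  let σ := Equiv.swap i (Fin.last n)
  have h1 := Conf.mk_perm M₀ x₀ c σ
  have h2 : Conf.mk M₀ x₀ ((c.comp σ.toEmbedding).comp Fin.castSuccEmb)
      = Conf.mk M₀ x₀ (c.comp σ.toEmbedding) := by
    refine Quot.sound (ConfRel.add _ ?_)
    have : (c.comp σ.toEmbedding).1 (Fin.last n) = c.1 i := by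
      change c.1 (σ (Fin.last n)) = c.1 i
      rw [Equiv.swap_apply_right]
    rw [this]
    exact hi
  have h3 : D.mk M₀ x₀ c = D.base M₀ x₀ (n + 1) :=
    Collapse.sound ⟨n, n.lt_succ_self, n, le_rfl, _, h2.trans h1⟩
      ⟨0, n.succ_pos, Conf.empty_mem_stage M₀ x₀ 0⟩
  unfold V.mk
  rw [dif_pos n.succ_pos, h3]
  exact V.incl_base M₀ x₀ _

theorem pairTerm_eq_zero (M₀ : Set M) (x₀ : X) {n : ℕ} (c : OrdConf M X n)
    (P : Finset (Fin n) × Finset (Fin n)) (i : Fin n) (hP : i ∈ P.1 ∪ P.2)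
    (hi : Vanishing M₀ x₀ (c.1 i)) : pairTerm M₀ x₀ c P = 0 := by
  have key : ∀ A : Finset (Fin n), i ∈ A → V.mk M₀ x₀ (c.restrict A) = V.base M₀ x₀ := by
    intro A hA
    have : i ∈ Set.range (A.orderEmbOfFin rfl) := by
      rw [Finset.range_orderEmbOfFin]
      exact hA
    obtain ⟨j, hj⟩ := this
    refine V.mk_eq_base M₀ x₀ _ j ?_
    change Vanishing M₀ x₀ (c.1 (A.orderEmbOfFin rfl j))
    rw [hj]
    exact hi
  rw [← SP.of_base]
  unfold pairTerm
  congr 1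
  refine Collapse.sound ?_ (Or.inl rfl)
  rcases Finset.mem_union.1 hP with h | h
  · exact Or.inl (key _ h)
  · exact Or.inr (key _ h)

theorem pairTerm_comp (M₀ : Set M) (x₀ : X) {m n : ℕ} (c : OrdConf M X n)
    (f : Fin m ↪ Fin n) (P : Finset (Fin m) × Finset (Fin m)) :
    pairTerm M₀ x₀ (c.comp f) P = pairTerm M₀ x₀ c (P.1.map f, P.2.map f) := by
  have key : ∀ A : Finset (Fin m),
      V.mk M₀ x₀ ((c.comp f).restrict A) = V.mk M₀ x₀ (c.restrict (A.map f)) := by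
    intro A
    refine V.mk_comp_eq M₀ x₀ c ((A.orderEmbOfFin rfl).toEmbedding.trans f)
      ((A.map f).orderEmbOfFin rfl).toEmbedding ?_
    have h1 := Finset.range_orderEmbOfFin A rfl
    have h2 := Finset.range_orderEmbOfFin (A.map f) rfl
    calc Set.range ((A.orderEmbOfFin rfl).toEmbedding.trans f)
        = f '' Set.range (A.orderEmbOfFin rfl) := Set.range_comp f (A.orderEmbOfFin rfl)
      _ = Set.range ((A.map f).orderEmbOfFin rfl) := by rw [h1, h2, Finset.coe_map]
  unfold pairTerm
  rw [key, key]

/-- Removing vanishing points and permuting the others does not change sums of `(ξ_A, ξ_B)` over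
pairs `(A, B)` subject to a condition that is invariant under injections of index sets. -/
theorem sum_pairTerm_comp (M₀ : Set M) (x₀ : X)
    (Q : (n : ℕ) → Finset (Fin n) × Finset (Fin n) → Prop) [∀ n, DecidablePred (Q n)]
    (hQ : ∀ (m n : ℕ) (f : Fin m ↪ Fin n) (P : Finset (Fin m) × Finset (Fin m)),
      Q n (P.1.map f, P.2.map f) ↔ Q m P)
    {m n : ℕ} (c : OrdConf M X n) (f : Fin m ↪ Fin n)
    (hf : ∀ i, i ∉ Set.range f → Vanishing M₀ x₀ (c.1 i)) :
    ∑ P with Q m P, pairTerm M₀ x₀ (c.comp f) P = ∑ P with Q n P, pairTerm M₀ x₀ c P := by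
  have hinj : Function.Injective
      fun P : Finset (Fin m) × Finset (Fin m) => (P.1.map f, P.2.map f) := by
    rintro ⟨A, B⟩ ⟨A', B'⟩ h
    simpa using h
  let F : Finset (Fin m) × Finset (Fin m) ↪ Finset (Fin n) × Finset (Fin n) := ⟨_, hinj⟩
  calc ∑ P with Q m P, pairTerm M₀ x₀ (c.comp f) P
      = ∑ P ∈ (Finset.univ.filter (Q m)).map F, pairTerm M₀ x₀ c P := by
        rw [Finset.sum_map]
        exact Finset.sum_congr rfl fun P _ => pairTerm_comp M₀ x₀ c f P
    _ = ∑ P with Q n P, pairTerm M₀ x₀ c P := by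
        refine Finset.sum_subset ?_ ?_
        · intro P hP
          obtain ⟨P', hP', rfl⟩ := Finset.mem_map.1 hP
          exact Finset.mem_filter.2 ⟨Finset.mem_univ _,
            (hQ m n f P').2 (Finset.mem_filter.1 hP').2⟩
        · intro P hP hP'
          by_cases h : ∀ i ∈ P.1 ∪ P.2, i ∈ Set.range f
          · exfalso
            have ex : ∀ A : Finset (Fin n), (∀ i ∈ A, i ∈ Set.range f) →
                ∃ A' : Finset (Fin m), A'.map f = A := fun A hA =>
              ⟨A.preimage f f.injective.injOn, by
                ext i
                simp only [Finset.mem_map, Finset.mem_preimage]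
                constructor
                · rintro ⟨j, hj, rfl⟩
                  exact hj
                · intro hi
                  obtain ⟨j, rfl⟩ := hA i hi
                  exact ⟨j, hi, rfl⟩⟩
            obtain ⟨A, hA⟩ := ex P.1 fun i hi => h i (Finset.mem_union_left _ hi)
            obtain ⟨B, hB⟩ := ex P.2 fun i hi => h i (Finset.mem_union_right _ hi)
            have hAB : (A.map f, B.map f) = P := Prod.ext hA hB
            refine hP' (Finset.mem_map.2 ⟨(A, B), Finset.mem_filter.2 ⟨Finset.mem_univ _, ?_⟩, hAB⟩)
            refine (hQ m n f (A, B)).1 ?_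
            rw [hAB]
            exact (Finset.mem_filter.1 hP).2
          · push Not at h
            obtain ⟨i, hi, hr⟩ := h
            exact pairTerm_eq_zero M₀ x₀ c P i hi (hf i hr)

theorem sum_pairTerm_rel (M₀ : Set M) (x₀ : X)
    (Q : (n : ℕ) → Finset (Fin n) × Finset (Fin n) → Prop) [∀ n, DecidablePred (Q n)]
    (hQ : ∀ (m n : ℕ) (f : Fin m ↪ Fin n) (P : Finset (Fin m) × Finset (Fin m)),
      Q n (P.1.map f, P.2.map f) ↔ Q m P)
    (ξ ξ' : Σ n, OrdConf M X n) (h : ConfRel M₀ x₀ ξ ξ') :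
    ∑ P with Q ξ.1 P, pairTerm M₀ x₀ ξ.2 P = ∑ P with Q ξ'.1 P, pairTerm M₀ x₀ ξ'.2 P := by
  cases h with
  | perm c σ =>
    exact sum_pairTerm_comp M₀ x₀ Q hQ c σ.toEmbedding fun i hi => absurd (σ.surjective i) hi
  | @add n c h =>
    refine sum_pairTerm_comp M₀ x₀ Q hQ c Fin.castSuccEmb fun i hi => ?_
    have : i = Fin.last n := by
      by_contra hne
      exact hi ⟨i.castPred hne, Fin.castSucc_castPred i hne⟩
    rw [this]
    exact h

theorem splitSum_rel (M₀ : Set M) (x₀ : X) (k : ℕ) (ξ ξ' : Σ n, OrdConf M X n)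
    (h : ConfRel M₀ x₀ ξ ξ') : splitSum M₀ x₀ k ξ = splitSum M₀ x₀ k ξ' :=
  sum_pairTerm_rel M₀ x₀ (fun _ P => (P.1 ∪ P.2).card = k ∧ Disjoint P.1 P.2)
    (fun m n f P => by
      simp only [← Finset.map_union, Finset.card_map, Finset.disjoint_map]) ξ ξ' h

theorem coverSum_rel (M₀ : Set M) (x₀ : X) (k : ℕ) (ξ ξ' : Σ n, OrdConf M X n)
    (h : ConfRel M₀ x₀ ξ ξ') : coverSum M₀ x₀ k ξ = coverSum M₀ x₀ k ξ' :=
  sum_pairTerm_rel M₀ x₀ (fun _ P => (P.1 ∪ P.2).card = k)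
    (fun m n f P => by simp only [← Finset.map_union, Finset.card_map]) ξ ξ' h

theorem card_union_ne {n k : ℕ} (h : n < k) (P : Finset (Fin n) × Finset (Fin n)) :
    (P.1 ∪ P.2).card ≠ k := by
  have := Finset.card_le_univ (P.1 ∪ P.2)
  rw [Fintype.card_fin] at this
  omega

theorem splitSum_lower (M₀ : Set M) (x₀ : X) (k : ℕ) {j : ℕ} (hj : j < k) (ξ : Conf M₀ x₀)
    (h : ξ ∈ Conf.stage M₀ x₀ j) :
    Quot.lift (splitSum M₀ x₀ k) (splitSum_rel M₀ x₀ k) ξ = 0 := by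
  obtain ⟨n, hn, c, rfl⟩ := h
  change splitSum M₀ x₀ k ⟨n, c⟩ = 0
  unfold splitSum
  rw [Finset.filter_false_of_mem fun P _ hP => card_union_ne (lt_of_le_of_lt hn hj) P hP.1, Finset.sum_empty]

theorem coverSum_lower (M₀ : Set M) (x₀ : X) (k : ℕ) {j : ℕ} (hj : j < k) (ξ : Conf M₀ x₀)
    (h : ξ ∈ Conf.stage M₀ x₀ j) :
    Quot.lift (coverSum M₀ x₀ k) (coverSum_rel M₀ x₀ k) ξ = 0 := by
  obtain ⟨n, hn, c, rfl⟩ := h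
  change coverSum M₀ x₀ k ⟨n, c⟩ = 0
  unfold coverSum
  rw [Finset.filter_false_of_mem fun P _ hP => card_union_ne (lt_of_le_of_lt hn hj) P hP, Finset.sum_empty]

/-- The restriction of `Φ` to `D_k`. -/
def PhiD (M₀ : Set M) (x₀ : X) (k : ℕ) : D M₀ x₀ k → SPVV M₀ x₀ :=
  Quot.lift (fun ξ => Quot.lift (splitSum M₀ x₀ k) (splitSum_rel M₀ x₀ k) ξ.1) (by
    rintro a b ⟨⟨i, hi, ha⟩, ⟨j, hj, hb⟩⟩
    exact (splitSum_lower M₀ x₀ k hi _ ha).trans (splitSum_lower M₀ x₀ k hj _ hb).symm)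

/-- The restriction of `Ψ` to `D_k`. -/
def PsiD (M₀ : Set M) (x₀ : X) (k : ℕ) : D M₀ x₀ k → SPVV M₀ x₀ :=
  Quot.lift (fun ξ => Quot.lift (coverSum M₀ x₀ k) (coverSum_rel M₀ x₀ k) ξ.1) (by
    rintro a b ⟨⟨i, hi, ha⟩, ⟨j, hj, hb⟩⟩
    exact (coverSum_lower M₀ x₀ k hi _ ha).trans (coverSum_lower M₀ x₀ k hj _ hb).symm)

theorem PhiD_base (M₀ : Set M) (x₀ : X) {k : ℕ} (hk : 0 < k) :
    PhiD M₀ x₀ k (D.base M₀ x₀ k) = 0 :=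
  splitSum_lower M₀ x₀ k hk _ (Conf.empty_mem_stage M₀ x₀ 0)

theorem PsiD_base (M₀ : Set M) (x₀ : X) {k : ℕ} (hk : 0 < k) :
    PsiD M₀ x₀ k (D.base M₀ x₀ k) = 0 :=
  coverSum_lower M₀ x₀ k hk _ (Conf.empty_mem_stage M₀ x₀ 0)

/-- The function `Φ : V → SP(V ∧ V)`, `ξ_I ↦ ∑_{I = A ⊔ B} (ξ_A, ξ_B)`. -/
def Phi (M₀ : Set M) (x₀ : X) : V M₀ x₀ → SPVV M₀ x₀ :=
  Quot.lift (fun p => PhiD M₀ x₀ p.1 p.2) (by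
    rintro ⟨i, a⟩ ⟨j, b⟩ ⟨ha, hb⟩
    exact ((congrArg (PhiD M₀ x₀ i.1) ha).trans (PhiD_base M₀ x₀ i.2)).trans
      ((congrArg (PhiD M₀ x₀ j.1) hb).trans (PhiD_base M₀ x₀ j.2)).symm)

/-- The function `Ψ : V → SP(V ∧ V)`, `ξ_I ↦ ∑_{I = A ∪ B} (ξ_A, ξ_B)`. -/
def Psi (M₀ : Set M) (x₀ : X) : V M₀ x₀ → SPVV M₀ x₀ :=
  Quot.lift (fun p => PsiD M₀ x₀ p.1 p.2) (by
    rintro ⟨i, a⟩ ⟨j, b⟩ ⟨ha, hb⟩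
    exact ((congrArg (PsiD M₀ x₀ i.1) ha).trans (PsiD_base M₀ x₀ i.2)).trans
      ((congrArg (PsiD M₀ x₀ j.1) hb).trans (PsiD_base M₀ x₀ j.2)).symm)

theorem Phi_base (M₀ : Set M) (x₀ : X) : Phi M₀ x₀ (V.base M₀ x₀) = 0 :=
  PhiD_base M₀ x₀ one_pos

theorem Psi_base (M₀ : Set M) (x₀ : X) : Psi M₀ x₀ (V.base M₀ x₀) = 0 :=
  PsiD_base M₀ x₀ one_pos

/-- The defining formula of `Φ`. -/
theorem Phi_mk (M₀ : Set M) (x₀ : X) {k : ℕ} (hk : 0 < k) (c : OrdConf M X k) :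
    Phi M₀ x₀ (V.mk M₀ x₀ c) =
      ∑ P : Finset (Fin k) × Finset (Fin k) with P.1 ∪ P.2 = Finset.univ ∧ Disjoint P.1 P.2,
        pairTerm M₀ x₀ c P := by
  have h : Phi M₀ x₀ (V.mk M₀ x₀ c) = splitSum M₀ x₀ k ⟨k, c⟩ := by
    unfold V.mk
    rw [dif_pos hk]
    rfl
  rw [h]
  refine Finset.sum_congr (Finset.filter_congr fun P _ => ?_) fun _ _ => rfl
  rw [← Finset.card_eq_iff_eq_univ, Fintype.card_fin]

/-- The defining formula of `Ψ`. -/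
theorem Psi_mk (M₀ : Set M) (x₀ : X) {k : ℕ} (hk : 0 < k) (c : OrdConf M X k) :
    Psi M₀ x₀ (V.mk M₀ x₀ c) =
      ∑ P : Finset (Fin k) × Finset (Fin k) with P.1 ∪ P.2 = Finset.univ,
        pairTerm M₀ x₀ c P := by
  have h : Psi M₀ x₀ (V.mk M₀ x₀ c) = coverSum M₀ x₀ k ⟨k, c⟩ := by
    unfold V.mk
    rw [dif_pos hk]
    rfl
  rw [h]
  refine Finset.sum_congr (Finset.filter_congr fun P _ => ?_) fun _ _ => rfl
  rw [← Finset.card_eq_iff_eq_univ, Fintype.card_fin]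

end

end LabelledConf

end

/-!
The homotopy comes from the fact that the diagonal of a sphere `X` of positive dimension is based
homotopic to a map into `X ∨ X`, that is, spheres have Lusternik–Schnirelmann category one: there
are homotopies `f_t, g_t : X → X`, fixing `x₀`, with `f_0 = g_0 = id` and with `f_1 x = x₀` or
`g_1 x = x₀` for each `x` (`exists_deformation_diagonal`). Here `f_1` collapses one of two
complementary hemispheres with `x₀` on their common boundary and `g_1` collapses the other one. Only
positivity of the dimension is used, not its parity.

Given `f_t` and `g_t`, put `H_t(ξ_I) = ∑_{I = A ∪ B} (ξ_A, ξ_B)`, where the labels of the doubled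
points, those with index in `A ∩ B`, are changed by `f_t` in `ξ_A` and by `g_t` in `ξ_B`. Then
`H_0 = Ψ`. At `t = 1` every doubled point has lost its label in `ξ_A` or in `ξ_B`, so the terms
with `A ∩ B` nonempty vanish and `H_1 = Φ` (`deformedSum_of_axes`). The sum is compatible with the
relations defining `V` because `f_t` and `g_t` fix `x₀` (`deformedSum_rel`).

Each stage of the construction of `V` is a quotient or a subspace of a quotient, and the sum over
the pairs with `#(A ∪ B) = k` is defined and continuous on all of `C(M, M₀; X)`. Hence `t ↦ H_t` is
continuous as a map from `V` to the space of paths in `SP(V ∧ V)` (`V.continuous_lift`); this gives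
the continuity of `Φ` and `Ψ` as well.
-/

noncomputable section

namespace LabelledConf

universe u v w

section

variable {M : Type u} {X : Type v}

/-! ### Continuity of the structure maps -/

/-- Although addition on `SP Y` need not be continuous, a finite sum of continuous families of
generators is, because it factors through a power of `Y`. -/
theorem SP.continuous_finsetSum {Z ι : Type*} {Y : Type u} [TopologicalSpace Z]
    [TopologicalSpace Y] (e : Y) (s : Finset ι) (F : ι → Z → Y) (hF : ∀ i, Continuous (F i)) :
    Continuous fun z => ∑ i ∈ s, SP.of e (F i z) := by
  have h : (fun z => ∑ i ∈ s, SP.of e (F i z)) =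
      SP.sum e ∘ fun z => ⟨s.card, fun j => F (s.equivFin.symm j) z⟩ := by
    funext z
    rw [← Finset.sum_coe_sort]
    exact (Equiv.sum_comp s.equivFin.symm fun i : s => SP.of e (F i z)).symm
  rw [h]
  exact (continuous_coinduced_rng (f := SP.sum e)).comp
    (continuous_sigmaMk.comp (continuous_pi fun j => hF _))

theorem continuous_collapseMk {Y : Type u} [TopologicalSpace Y] (S : Set Y) :
    Continuous (Collapse.mk S) :=
  continuous_quot_mk

theorem V.continuous_mk [TopologicalSpace M] [TopologicalSpace X] (M₀ : Set M) (x₀ : X) (n : ℕ) :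
    Continuous (V.mk M₀ x₀ : OrdConf M X n → V M₀ x₀) := by
  by_cases hn : 0 < n
  · have hC : Continuous (Conf.mk M₀ x₀ : OrdConf M X n → Conf M₀ x₀) :=
      continuous_quot_mk.comp continuous_sigmaMk
    have hD : Continuous (D.mk M₀ x₀ : OrdConf M X n → D M₀ x₀ n) :=
      (continuous_collapseMk _).comp (hC.subtype_mk _)
    have hV : Continuous (V.incl M₀ x₀ ⟨n, hn⟩) :=
      (continuous_collapseMk _).comp
        (continuous_sigmaMk (ι := {k : ℕ // 0 < k}) (i := ⟨n, hn⟩))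
    have : (V.mk M₀ x₀ : OrdConf M X n → V M₀ x₀) = V.incl M₀ x₀ ⟨n, hn⟩ ∘ D.mk M₀ x₀ := by
      funext c
      exact dif_pos hn
    rw [this]
    exact hV.comp hD
  · have : (V.mk M₀ x₀ : OrdConf M X n → V M₀ x₀) = fun _ => V.base M₀ x₀ := by
      funext c
      exact dif_neg hn
    rw [this]
    exact continuous_const

theorem OrdConf.continuous_comp [TopologicalSpace M] [TopologicalSpace X] {m n : ℕ}
    (e : Fin m ↪ Fin n) : Continuous fun c : OrdConf M X n => c.comp e :=
  have h : Continuous fun (c : OrdConf M X n) (i : Fin m) => c.1 (e i) :=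
    continuous_pi fun i => (continuous_apply (e i)).comp continuous_subtype_val
  h.subtype_mk _

/-! ### Maps out of `V` -/

/-- The map `D_k → Z` given by a function `S` of ordered configurations that is compatible with the
identifications in `C(M, M₀; X)` and constant on configurations of fewer than `k` points. The
function `S` has to be given on configurations of all sizes: `C_k` has the subspace topology from
`C(M, M₀; X)`, so continuity is checked on the whole of `C(M, M₀; X)`. -/
def D.lift (M₀ : Set M) (x₀ : X) {Z : Type w} (k : ℕ) (S : (Σ n, OrdConf M X n) → Z) (z₀ : Z)
    (hrel : ∀ ξ ξ', ConfRel M₀ x₀ ξ ξ' → S ξ = S ξ') (hlow : ∀ ξ, ξ.1 < k → S ξ = z₀) :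
    D M₀ x₀ k → Z :=
  Quot.lift (fun ξ : Conf.stage M₀ x₀ k => Quot.lift S hrel ξ.1) (by
    have hstage : ∀ a : Conf.stage M₀ x₀ k, a ∈ Conf.lower M₀ x₀ k →
        Quot.lift S hrel a.1 = z₀ := by
      rintro ⟨_, _⟩ ⟨j, hj, n, hn, c, rfl⟩
      exact hlow ⟨n, c⟩ (lt_of_le_of_lt hn hj)
    exact fun a b h => (hstage a h.1).trans (hstage b h.2).symm)

theorem D.continuous_lift [TopologicalSpace M] [TopologicalSpace X] (M₀ : Set M) (x₀ : X)
    {Z : Type w} [TopologicalSpace Z] (k : ℕ) (S : (Σ n, OrdConf M X n) → Z) (z₀ : Z)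
    (hrel : ∀ ξ ξ', ConfRel M₀ x₀ ξ ξ' → S ξ = S ξ') (hlow : ∀ ξ, ξ.1 < k → S ξ = z₀)
    (hS : Continuous S) : Continuous (D.lift M₀ x₀ k S z₀ hrel hlow) :=
  have h : Continuous (Quot.lift S hrel : Conf M₀ x₀ → Z) := continuous_quot_lift hrel hS
  continuous_quot_lift _ (h.comp continuous_subtype_val)

/-- The map `V → Z` given on each `D_k` by `D.lift`. -/
def V.lift (M₀ : Set M) (x₀ : X) {Z : Type w} (S : ℕ → (Σ n, OrdConf M X n) → Z) (z₀ : Z)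
    (hrel : ∀ k ξ ξ', ConfRel M₀ x₀ ξ ξ' → S k ξ = S k ξ')
    (hlow : ∀ k ξ, ξ.1 < k → S k ξ = z₀) : V M₀ x₀ → Z :=
  Quot.lift (fun p => D.lift M₀ x₀ p.1.1 (S p.1.1) z₀ (hrel _) (hlow _) p.2) (by
    have hbase : ∀ k : {k : ℕ // 0 < k},
        D.lift M₀ x₀ k.1 (S k.1) z₀ (hrel _) (hlow _) (D.base M₀ x₀ k.1) = z₀ :=
      fun k => hlow k.1 ⟨0, _⟩ k.2
    rintro ⟨i, a⟩ ⟨j, b⟩ ⟨ha, hb⟩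
    exact ((congrArg _ ha).trans (hbase i)).trans ((congrArg _ hb).trans (hbase j)).symm)

theorem V.continuous_lift [TopologicalSpace M] [TopologicalSpace X] (M₀ : Set M) (x₀ : X)
    {Z : Type w} [TopologicalSpace Z] (S : ℕ → (Σ n, OrdConf M X n) → Z) (z₀ : Z)
    (hrel : ∀ k ξ ξ', ConfRel M₀ x₀ ξ ξ' → S k ξ = S k ξ')
    (hlow : ∀ k ξ, ξ.1 < k → S k ξ = z₀) (hS : ∀ k, Continuous (S k)) :
    Continuous (V.lift M₀ x₀ S z₀ hrel hlow) :=
  continuous_quot_lift _ (continuous_sigma fun k =>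
    D.continuous_lift M₀ x₀ k.1 (S k.1) z₀ (hrel _) (hlow _) (hS _))

theorem V.lift_base (M₀ : Set M) (x₀ : X) {Z : Type w} (S : ℕ → (Σ n, OrdConf M X n) → Z) (z₀ : Z)
    (hrel : ∀ k ξ ξ', ConfRel M₀ x₀ ξ ξ' → S k ξ = S k ξ')
    (hlow : ∀ k ξ, ξ.1 < k → S k ξ = z₀) :
    V.lift M₀ x₀ S z₀ hrel hlow (V.base M₀ x₀) = z₀ :=
  hlow 1 ⟨0, _⟩ one_pos

/-- Every point of `V` is represented by an ordered configuration in some `C_k` with `k ≥ 1`. -/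
theorem V.ind {M₀ : Set M} {x₀ : X} {p : V M₀ x₀ → Prop}
    (h : ∀ (k : ℕ) (hk : 0 < k) (n : ℕ) (c : OrdConf M X n)
      (hc : Conf.mk M₀ x₀ c ∈ Conf.stage M₀ x₀ k),
      p (V.incl M₀ x₀ ⟨k, hk⟩ (Collapse.mk _ ⟨Conf.mk M₀ x₀ c, hc⟩))) (y : V M₀ x₀) : p y := by
  obtain ⟨⟨⟨k, hk⟩, d⟩⟩ := y
  obtain ⟨⟨ξ, hξ⟩⟩ := d
  obtain ⟨⟨n, c⟩⟩ := ξ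
  exact h k hk n c hξ

/-! ### Deforming the labels of doubled points -/

/-- The configuration with the same points, in which the label `x` of the point of index `i` is
replaced by `φ i x`. -/
def OrdConf.relabel {n : ℕ} (c : OrdConf M X n) (φ : Fin n → X → X) : OrdConf M X n :=
  ⟨fun i => ((c.1 i).1, φ i (c.1 i).2), c.2⟩

/-- The element of `SP(V ∧ V)` given by `(ξ_A, ξ_B)`, where the labels of the points with index in
`A ∩ B` are changed by `f` in `ξ_A` and by `g` in `ξ_B`. -/
def deformedTerm (M₀ : Set M) (x₀ : X) (f g : X → X) {n : ℕ} (c : OrdConf M X n)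
    (P : Finset (Fin n) × Finset (Fin n)) : SPVV M₀ x₀ :=
  SP.of _ (Smash.mk _ _
    (V.mk M₀ x₀ ((c.relabel fun i => if i ∈ P.1 ∩ P.2 then f else id).restrict P.1))
    (V.mk M₀ x₀ ((c.relabel fun i => if i ∈ P.1 ∩ P.2 then g else id).restrict P.2)))

theorem OrdConf.relabel_id {n : ℕ} (c : OrdConf M X n) (φ : Fin n → X → X)
    (h : ∀ i, φ i = id) : c.relabel φ = c := by
  apply Subtype.ext
  funext i
  simp [relabel, h]

theorem V.mk_restrict_eq_base (M₀ : Set M) (x₀ : X) {n : ℕ} (c : OrdConf M X n)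
    (A : Finset (Fin n)) (i : Fin n) (hA : i ∈ A) (hi : Vanishing M₀ x₀ (c.1 i)) :
    V.mk M₀ x₀ (c.restrict A) = V.base M₀ x₀ := by
  have : i ∈ Set.range (A.orderEmbOfFin rfl) := by
    rw [Finset.range_orderEmbOfFin]
    exact hA
  obtain ⟨j, rfl⟩ := this
  exact V.mk_eq_base M₀ x₀ _ j hi

theorem V.mk_restrict_comp (M₀ : Set M) (x₀ : X) {m n : ℕ} (c : OrdConf M X n)
    (e : Fin m ↪ Fin n) (A : Finset (Fin m)) :
    V.mk M₀ x₀ ((c.comp e).restrict A) = V.mk M₀ x₀ (c.restrict (A.map e)) := by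
  refine V.mk_comp_eq M₀ x₀ c ((A.orderEmbOfFin rfl).toEmbedding.trans e)
    ((A.map e).orderEmbOfFin rfl).toEmbedding ?_
  have h1 := Finset.range_orderEmbOfFin A rfl
  have h2 := Finset.range_orderEmbOfFin (A.map e) rfl
  calc Set.range ((A.orderEmbOfFin rfl).toEmbedding.trans e)
      = e '' Set.range (A.orderEmbOfFin rfl) := Set.range_comp e (A.orderEmbOfFin rfl)
    _ = Set.range ((A.map e).orderEmbOfFin rfl) := by rw [h1, h2, Finset.coe_map]

theorem SP.of_smashMk_eq_zero {M₀ : Set M} {x₀ : X} {y z : V M₀ x₀}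
    (h : y = V.base M₀ x₀ ∨ z = V.base M₀ x₀) :
    (SP.of _ (Smash.mk _ _ y z) : SPVV M₀ x₀) = 0 := by
  rw [← SP.of_base]
  exact congrArg _ (Collapse.sound h (Or.inl rfl))

theorem deformedTerm_eq_zero (M₀ : Set M) (x₀ : X) {f g : X → X} (hf : f x₀ = x₀)
    (hg : g x₀ = x₀) {n : ℕ} (c : OrdConf M X n) (P : Finset (Fin n) × Finset (Fin n))
    (i : Fin n) (hP : i ∈ P.1 ∪ P.2) (hi : Vanishing M₀ x₀ (c.1 i)) :
    deformedTerm M₀ x₀ f g c P = 0 := by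
  have key : ∀ φ : Fin n → X → X, φ i x₀ = x₀ → Vanishing M₀ x₀ ((c.relabel φ).1 i) := by
    intro φ hφ
    refine hi.imp id fun h => ?_
    change φ i (c.1 i).2 = x₀
    rw [h, hφ]
  refine SP.of_smashMk_eq_zero ((Finset.mem_union.1 hP).imp (fun h => ?_) fun h => ?_)
  · refine V.mk_restrict_eq_base M₀ x₀ _ _ i h (key _ ?_)
    split_ifs <;> simp [hf]
  · refine V.mk_restrict_eq_base M₀ x₀ _ _ i h (key _ ?_)
    split_ifs <;> simp [hg]

theorem deformedTerm_comp (M₀ : Set M) (x₀ : X) (f g : X → X) {m n : ℕ} (c : OrdConf M X n)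
    (e : Fin m ↪ Fin n) (P : Finset (Fin m) × Finset (Fin m)) :
    deformedTerm M₀ x₀ f g (c.comp e) P = deformedTerm M₀ x₀ f g c (P.1.map e, P.2.map e) := by
  have key : ∀ (h : X → X), (c.comp e).relabel (fun i => if i ∈ P.1 ∩ P.2 then h else id) =
      (c.relabel fun i => if i ∈ P.1.map e ∩ P.2.map e then h else id).comp e := by
    intro h
    apply Subtype.ext
    funext i
    simp [OrdConf.relabel, OrdConf.comp]
  unfold deformedTerm
  rw [key, key, V.mk_restrict_comp, V.mk_restrict_comp]

/-- The sum of the deformed terms `(ξ_A, ξ_B)` over the pairs with `#(A ∪ B) = k`. For `f = g = id`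
it is `coverSum`. -/
def deformedSum (M₀ : Set M) (x₀ : X) (f g : X → X) (k : ℕ) (ξ : Σ n, OrdConf M X n) :
    SPVV M₀ x₀ :=
  ∑ P : Finset (Fin ξ.1) × Finset (Fin ξ.1) with (P.1 ∪ P.2).card = k,
    deformedTerm M₀ x₀ f g ξ.2 P

theorem deformedSum_comp (M₀ : Set M) (x₀ : X) {f g : X → X} (hf : f x₀ = x₀) (hg : g x₀ = x₀)
    (k : ℕ) {m n : ℕ} (c : OrdConf M X n) (e : Fin m ↪ Fin n)
    (he : ∀ i, i ∉ Set.range e → Vanishing M₀ x₀ (c.1 i)) :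
    deformedSum M₀ x₀ f g k ⟨m, c.comp e⟩ = deformedSum M₀ x₀ f g k ⟨n, c⟩ := by
  refine Finset.sum_of_injOn
    (fun P : Finset (Fin m) × Finset (Fin m) => (P.1.map e, P.2.map e)) ?_ ?_ ?_ ?_
  · rintro ⟨A, B⟩ - ⟨A', B'⟩ - h
    simpa using h
  · intro P hP
    simpa [← Finset.map_union] using hP
  · rintro ⟨A, B⟩ hP hP'
    -- a pair of subsets which does not come from `Fin m` involves a vanishing point
    obtain ⟨i, hi, hr⟩ : ∃ i ∈ A ∪ B, i ∉ Set.range e := by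
      by_contra! h
      have ex : ∀ A' ⊆ A ∪ B, ∃ A'' : Finset (Fin m), A''.map e = A' := fun A' hA' => by
        have hsub : A' ⊆ Finset.univ.map e := fun i hi => by
          obtain ⟨j, rfl⟩ := h i (hA' hi)
          exact Finset.mem_map_of_mem _ (Finset.mem_univ j)
        obtain ⟨s, -, hs⟩ := Finset.subset_map_iff.1 hsub
        exact ⟨s, hs.symm⟩
      obtain ⟨A', rfl⟩ := ex A Finset.subset_union_left
      obtain ⟨B', rfl⟩ := ex B Finset.subset_union_right
      exact hP' ⟨(A', B'), by simpa [← Finset.map_union] using hP, rfl⟩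
    exact deformedTerm_eq_zero M₀ x₀ hf hg c _ i hi (he i hr)
  · exact fun P _ => deformedTerm_comp M₀ x₀ f g c e P

theorem deformedSum_rel (M₀ : Set M) (x₀ : X) {f g : X → X} (hf : f x₀ = x₀) (hg : g x₀ = x₀)
    (k : ℕ) (ξ ξ' : Σ n, OrdConf M X n) (h : ConfRel M₀ x₀ ξ ξ') :
    deformedSum M₀ x₀ f g k ξ = deformedSum M₀ x₀ f g k ξ' := by
  cases h with
  | perm c σ =>
    exact deformedSum_comp M₀ x₀ hf hg k c σ.toEmbedding fun i hi => absurd (σ.surjective i) hi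
  | @add n c h =>
    refine deformedSum_comp M₀ x₀ hf hg k c Fin.castSuccEmb fun i hi => ?_
    have : i = Fin.last n := by
      by_contra hne
      exact hi ⟨i.castPred hne, Fin.castSucc_castPred i hne⟩
    rwa [this]

theorem deformedSum_lower (M₀ : Set M) (x₀ : X) (f g : X → X) (k : ℕ) (ξ : Σ n, OrdConf M X n)
    (h : ξ.1 < k) : deformedSum M₀ x₀ f g k ξ = 0 :=
  Finset.sum_eq_zero fun P hP => absurd (Finset.mem_filter.1 hP).2 (card_union_ne h P)

theorem deformedTerm_of_disjoint (M₀ : Set M) (x₀ : X) (f g : X → X) {n : ℕ}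
    (c : OrdConf M X n) (P : Finset (Fin n) × Finset (Fin n)) (h : Disjoint P.1 P.2) :
    deformedTerm M₀ x₀ f g c P = pairTerm M₀ x₀ c P := by
  have h0 : P.1 ∩ P.2 = ∅ := Finset.disjoint_iff_inter_eq_empty.1 h
  unfold deformedTerm pairTerm
  rw [OrdConf.relabel_id, OrdConf.relabel_id] <;> simp [h0]

theorem deformedSum_id (M₀ : Set M) (x₀ : X) (k : ℕ) (ξ : Σ n, OrdConf M X n) :
    deformedSum M₀ x₀ id id k ξ = coverSum M₀ x₀ k ξ := by
  refine Finset.sum_congr rfl fun P _ => ?_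
  unfold deformedTerm pairTerm
  rw [OrdConf.relabel_id _ _ fun i => ite_self _]

/-- If `(f, g) : X → X × X` takes values in `X ∨ X`, then only the terms with `A` and `B` disjoint
survive in the deformed sum. -/
theorem deformedSum_of_axes (M₀ : Set M) (x₀ : X) {f g : X → X}
    (hfg : ∀ x, f x = x₀ ∨ g x = x₀) (k : ℕ) (ξ : Σ n, OrdConf M X n) :
    deformedSum M₀ x₀ f g k ξ = splitSum M₀ x₀ k ξ := by
  unfold deformedSum splitSum
  rw [← Finset.filter_filter]
  refine Eq.symm ((Finset.sum_congr rfl fun P hP => ?_).trans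
    (Finset.sum_filter_of_ne fun P _ hP => ?_))
  · exact (deformedTerm_of_disjoint M₀ x₀ f g ξ.2 P (Finset.mem_filter.1 hP).2).symm
  · rw [Finset.disjoint_left]
    intro i h1 h2
    have hi : i ∈ P.1 ∩ P.2 := Finset.mem_inter.2 ⟨h1, h2⟩
    refine hP (SP.of_smashMk_eq_zero ((hfg (ξ.2.1 i).2).imp (fun h => ?_) fun h => ?_))
    · refine V.mk_restrict_eq_base M₀ x₀ _ _ i h1 (Or.inr ?_)
      simpa only [OrdConf.relabel, if_pos hi] using h
    · refine V.mk_restrict_eq_base M₀ x₀ _ _ i h2 (Or.inr ?_)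
      simpa only [OrdConf.relabel, if_pos hi] using h

theorem OrdConf.continuous_relabel [TopologicalSpace M] [TopologicalSpace X] {T : Type*}
    [TopologicalSpace T] {n : ℕ} (φ : T → Fin n → X → X)
    (hφ : ∀ i, Continuous fun p : T × X => φ p.1 i p.2) :
    Continuous fun p : OrdConf M X n × T => p.1.relabel (φ p.2) := by
  have h : ∀ i, Continuous fun p : OrdConf M X n × T => p.1.1 i := fun i =>
    (continuous_apply i).comp (continuous_subtype_val.comp continuous_fst)
  exact (continuous_pi fun i => (continuous_fst.comp (h i)).prodMk
    ((hφ i).comp (continuous_snd.prodMk (continuous_snd.comp (h i))))).subtype_mk _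

theorem continuous_deformedSum [TopologicalSpace M] [TopologicalSpace X] {T : Type*}
    [TopologicalSpace T] (M₀ : Set M) (x₀ : X) {f g : T × X → X} (hf : Continuous f)
    (hg : Continuous g) (k n : ℕ) :
    Continuous fun p : OrdConf M X n × T =>
      deformedSum M₀ x₀ (fun x => f (p.2, x)) (fun x => g (p.2, x)) k ⟨n, p.1⟩ := by
  have key : ∀ (f : T × X → X), Continuous f → ∀ A B : Finset (Fin n),
      Continuous fun p : OrdConf M X n × T => V.mk M₀ x₀
        ((p.1.relabel fun i => if i ∈ B then fun x => f (p.2, x) else id).restrict A) := by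
    intro f hf A B
    refine (V.continuous_mk M₀ x₀ _).comp ((OrdConf.continuous_comp _).comp
      (OrdConf.continuous_relabel (fun t i => if i ∈ B then fun x => f (t, x) else id)
        fun i => ?_))
    by_cases hi : i ∈ B
    · simpa [hi] using hf
    · simpa [hi] using continuous_snd
  have hP := fun P : Finset (Fin n) × Finset (Fin n) =>
    (continuous_collapseMk (axes (V.base M₀ x₀) (V.base M₀ x₀))).comp
      ((key f hf P.1 (P.1 ∩ P.2)).prodMk (key g hg P.2 (P.1 ∩ P.2)))
  change Continuous fun p : OrdConf M X n × T =>
    ∑ P : Finset (Fin n) × Finset (Fin n) with (P.1 ∪ P.2).card = k,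
      deformedTerm M₀ x₀ (fun x => f (p.2, x)) (fun x => g (p.2, x)) p.1 P
  exact SP.continuous_finsetSum (Smash.base (V.base M₀ x₀) (V.base M₀ x₀)) _ _ hP

/-! ### The homotopy -/

open scoped unitInterval in
/-- If the diagonal of `X` deforms, relative to the basepoint, into `X ∨ X`, then `Φ` and `Ψ` are
continuous and based homotopic. -/
theorem exists_homotopicRel_Phi_Psi [TopologicalSpace M] [TopologicalSpace X] (M₀ : Set M) (x₀ : X)
    {f g : I × X → X} (hf : Continuous f) (hg : Continuous g)
    (hf0 : ∀ x, f (0, x) = x) (hg0 : ∀ x, g (0, x) = x)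
    (hfx : ∀ t, f (t, x₀) = x₀) (hgx : ∀ t, g (t, x₀) = x₀)
    (hfg : ∀ x, f (1, x) = x₀ ∨ g (1, x) = x₀) :
    ∃ (hΦ : Continuous (Phi M₀ x₀)) (hΨ : Continuous (Psi M₀ x₀)),
      ContinuousMap.HomotopicRel (⟨Phi M₀ x₀, hΦ⟩ : C(V M₀ x₀, SPVV M₀ x₀)) ⟨Psi M₀ x₀, hΨ⟩
        {V.base M₀ x₀} := by
  have hc := fun k n => continuous_deformedSum M₀ x₀ hf hg k n
  have hpath : ∀ k (ξ : Σ n, OrdConf M X n),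
      Continuous fun t => deformedSum M₀ x₀ (fun x => f (t, x)) (fun x => g (t, x)) k ξ := by
    rintro k ⟨n, c⟩
    have h1 : Continuous fun t : I => (c, t) := Continuous.prodMk_right c
    have h := (hc k n).comp h1
    exact h
  let S : ℕ → (Σ n, OrdConf M X n) → C(I, SPVV M₀ x₀) := fun k ξ => ⟨_, hpath k ξ⟩
  -- Being a map from `V` to the path space, the homotopy can be lifted through the quotients that
  -- define `V`; a product of a quotient map with `I` is not needed.
  have hrel : ∀ k ξ ξ', ConfRel M₀ x₀ ξ ξ' → S k ξ = S k ξ' := fun k ξ ξ' h => by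
    ext t : 1
    exact deformedSum_rel M₀ x₀ (f := fun x => f (t, x)) (g := fun x => g (t, x))
      (hfx t) (hgx t) k ξ ξ' h
  have hlow : ∀ k ξ, ξ.1 < k → S k ξ = ContinuousMap.const I 0 := fun k ξ h =>
    ContinuousMap.ext fun t => deformedSum_lower M₀ x₀ _ _ k ξ h
  have hS : ∀ k, Continuous (S k) := fun k => continuous_sigma fun n =>
    ContinuousMap.continuous_of_continuous_uncurry _ (hc k n)
  let H : V M₀ x₀ → C(I, SPVV M₀ x₀) := V.lift M₀ x₀ S _ hrel hlow
  have hH : Continuous H := V.continuous_lift M₀ x₀ S _ hrel hlow hS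
  have h0 : ∀ y, H y 0 = Psi M₀ x₀ y := V.ind fun k _ n c _ => by
    change deformedSum M₀ x₀ (fun x => f (0, x)) (fun x => g (0, x)) k ⟨n, c⟩ =
      coverSum M₀ x₀ k ⟨n, c⟩
    simp only [hf0, hg0]
    exact deformedSum_id M₀ x₀ k ⟨n, c⟩
  have h1 : ∀ y, H y 1 = Phi M₀ x₀ y := V.ind fun k _ n c _ =>
    deformedSum_of_axes M₀ x₀ hfg k ⟨n, c⟩
  have hbase : ∀ t, H (V.base M₀ x₀) t = 0 :=
    DFunLike.congr_fun (V.lift_base M₀ x₀ S _ hrel hlow)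
  have hΨ : Continuous (Psi M₀ x₀) := by
    rw [← funext h0]
    exact (continuous_eval_const 0).comp hH
  have hΦ : Continuous (Phi M₀ x₀) := by
    rw [← funext h1]
    exact (continuous_eval_const 1).comp hH
  refine ⟨hΦ, hΨ, ContinuousMap.HomotopicRel.symm ⟨⟨⟨⟨fun p => H p.2 p.1, ?_⟩, h0, h1⟩, ?_⟩⟩⟩
  · exact (ContinuousMap.continuous_uncurry_of_continuous ⟨H, hH⟩).comp continuous_swap
  · rintro t y rfl
    exact (hbase t).trans (Psi_base M₀ x₀).symm

end

/-! ### Spheres have Lusternik–Schnirelmann category one -/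

section Sphere

variable {E : Type*} [NormedAddCommGroup E] [InnerProductSpace ℝ E]

open Metric
open scoped unitInterval

/-- Normalising a family of vectors that vanishes nowhere gives a family of maps of the sphere. -/
theorem exists_continuous_normalize (G : I × sphere (0 : E) 1 → E) (hG : Continuous G)
    (h0 : ∀ p, G p ≠ 0) :
    ∃ F : I × sphere (0 : E) 1 → sphere (0 : E) 1, Continuous F ∧
      ∀ p, (F p : E) = ‖G p‖⁻¹ • G p := by
  refine ⟨fun p => ⟨‖G p‖⁻¹ • G p, ?_⟩, ?_, fun _ => rfl⟩
  · rw [mem_sphere_zero_iff_norm, norm_smul, norm_inv, norm_norm,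
      inv_mul_cancel₀ (norm_ne_zero_iff.2 (h0 p))]
  · exact ((hG.norm.inv₀ fun p => norm_ne_zero_iff.2 (h0 p)).smul hG).subtype_mk _

/-- The identity of the sphere is homotopic, relative to `x₀`, to a map which collapses the
hemisphere centred at `x₀` to `x₀`. -/
theorem exists_collapse_hemisphere (x₀ : sphere (0 : E) 1) :
    ∃ F : I × sphere (0 : E) 1 → sphere (0 : E) 1, Continuous F ∧ (∀ x, F (0, x) = x) ∧
      (∀ t, F (t, x₀) = x₀) ∧ ∀ x : sphere (0 : E) 1, 0 ≤ inner ℝ (x : E) x₀ → F (1, x) = x₀ := by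
  let a : sphere (0 : E) 1 → ℝ := fun x => inner ℝ (x : E) x₀
  have hx₀ : ‖(x₀ : E)‖ = 1 := norm_eq_of_mem_sphere x₀
  have ha0 : a x₀ = 1 := by simp [a]
  have hac : Continuous a := by fun_prop
  -- The component of `x` orthogonal to `x₀` is multiplied by a factor `μ` which at time `1`
  -- vanishes exactly where `0 ≤ a`, and `t * (1 - a ^ 2)` is added to the component `a` along `x₀`.
  let μ : I × sphere (0 : E) 1 → ℝ := fun p => (1 - p.1) + p.1 * max 0 (-a p.2)
  let ν : I × sphere (0 : E) 1 → ℝ := fun p => a p.2 + p.1 * (1 - a p.2 ^ 2)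
  let G : I × sphere (0 : E) 1 → E := fun p =>
    μ p • ((p.2 : E) - a p.2 • (x₀ : E)) + ν p • (x₀ : E)
  have hGc : Continuous G := by fun_prop
  have hG0 : ∀ p, G p ≠ 0 := by
    rintro ⟨⟨t, ht0, ht1⟩, x⟩ h
    have hx : ‖(x : E)‖ = 1 := norm_eq_of_mem_sphere x
    have hν : ν (⟨t, ht0, ht1⟩, x) = 0 := by
      have := congrArg (fun y => inner ℝ y (x₀ : E)) h
      simpa [G, inner_add_left, inner_sub_left, inner_smul_left, a, hx₀] using this
    have hw : μ (⟨t, ht0, ht1⟩, x) • ((x : E) - a x • (x₀ : E)) = 0 := by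
      have h' := h
      simp only [G, hν, zero_smul, add_zero] at h'
      exact h'
    have hle : a x ≤ 1 := by
      simpa [hx, hx₀] using real_inner_le_norm (x : E) x₀
    simp only [ν] at hν
    rcases smul_eq_zero.1 hw with hμ | hw
    · simp only [μ] at hμ
      have h1 : 0 ≤ t * max 0 (-a x) := mul_nonneg ht0 (le_max_left _ _)
      obtain rfl : t = 1 := by linarith
      have h2 : -a x ≤ 0 := by
        have := le_max_right 0 (-a x)
        linarith
      nlinarith
    · have h3 : (x : E) = a x • (x₀ : E) := sub_eq_zero.1 hw
      have h4 : a x ^ 2 = 1 := by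
        have := congrArg (fun y => ‖y‖) h3
        simp only [norm_smul, hx, hx₀, mul_one, Real.norm_eq_abs] at this
        rw [← sq_abs, ← this, one_pow]
      rw [h4] at hν
      nlinarith
  obtain ⟨F, hF, hFG⟩ := exists_continuous_normalize G hGc hG0
  refine ⟨F, hF, fun x => ?_, fun t => ?_, fun x hx => ?_⟩ <;> apply Subtype.ext <;> rw [hFG]
  · have : G (0, x) = x := by simp [G, μ, ν]
    rw [this, norm_eq_of_mem_sphere x, inv_one, one_smul]
  · have : G (t, x₀) = x₀ := by simp [G, ν, ha0]
    rw [this, hx₀, inv_one, one_smul]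
  · have hμ : μ (1, x) = 0 := by
      have : 0 ≤ a x := hx
      simp [μ, this]
    have hle : a x ≤ 1 := by
      simpa [hx₀] using real_inner_le_norm (x : E) x₀
    have hν : 0 < ν (1, x) := by
      have : 0 ≤ a x := hx
      simp only [ν, Set.Icc.coe_one]
      nlinarith
    simp only [G, hμ, zero_smul, zero_add, norm_smul, hx₀, mul_one, Real.norm_of_nonneg hν.le,
      smul_smul, inv_mul_cancel₀ hν.ne', one_smul]

/-- For `v` orthogonal to `x₀`, the identity of the sphere is homotopic, relative to `x₀`, to a map
which takes the hemisphere centred at `-v` into the hemisphere centred at `x₀`. -/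
theorem exists_push_hemisphere (x₀ : sphere (0 : E) 1) (v : E) (hv : ‖v‖ = 1)
    (hvx : inner ℝ v (x₀ : E) = 0) :
    ∃ F : I × sphere (0 : E) 1 → sphere (0 : E) 1, Continuous F ∧ (∀ x, F (0, x) = x) ∧
      (∀ t, F (t, x₀) = x₀) ∧
      ∀ x : sphere (0 : E) 1, inner ℝ (x : E) v ≤ 0 → 0 ≤ inner ℝ (F (1, x) : E) x₀ := by
  let a : sphere (0 : E) 1 → ℝ := fun x => inner ℝ (x : E) x₀
  let b : sphere (0 : E) 1 → ℝ := fun x => inner ℝ (x : E) v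
  have hx₀ : ‖(x₀ : E)‖ = 1 := norm_eq_of_mem_sphere x₀
  have hxv : inner ℝ (x₀ : E) v = 0 := by rw [real_inner_comm, hvx]
  have ha0 : a x₀ = 1 := by simp [a]
  have hb0 : b x₀ = 0 := hxv
  have hac : Continuous a := by fun_prop
  have hbc : Continuous b := by fun_prop
  -- Points with `a < 0` are pushed by `-a` towards `-v`; the push by `α` towards `x₀` makes `a`
  -- nonnegative where `b ≤ 0`, but is too short for that where `0 < b`, where the push towards `-v`
  -- may bring the `v`-component to zero. This keeps the pushed vector away from the origin.
  let α : sphere (0 : E) 1 → ℝ := fun x => max 0 (-a x - max (b x) 0)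
  let β : sphere (0 : E) 1 → ℝ := fun x => max 0 (-a x)
  let G : I × sphere (0 : E) 1 → E := fun p =>
    (p.2 : E) + ((p.1 : ℝ) * α p.2) • (x₀ : E) - ((p.1 : ℝ) * β p.2) • v
  have hGc : Continuous G := by fun_prop
  have hGa : ∀ p, inner ℝ (G p) (x₀ : E) = a p.2 + p.1 * α p.2 := fun p => by
    simp [G, inner_add_left, inner_sub_left, inner_smul_left, hx₀, hvx, a]
  have hGb : ∀ p, inner ℝ (G p) v = b p.2 - p.1 * β p.2 := fun p => by
    simp [G, inner_add_left, inner_sub_left, inner_smul_left, hv, hxv, b]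
  have hG0 : ∀ p, G p ≠ 0 := by
    rintro ⟨⟨t, ht0, ht1⟩, x⟩ h
    have h1 := hGa (⟨t, ht0, ht1⟩, x)
    have h2 := hGb (⟨t, ht0, ht1⟩, x)
    rw [h, inner_zero_left] at h1 h2
    simp only at h1 h2
    have hβ0 : 0 ≤ β x := le_max_left _ _
    have hα0 : 0 ≤ α x := le_max_left _ _
    have hb : 0 ≤ b x := by nlinarith
    have hα : α x = max 0 (-a x - b x) := by simp only [α, max_eq_left hb]
    have htα : t * α x ≤ α x := mul_le_of_le_one_left hα0 ht1
    have hzero : t * α x = 0 ∧ t * β x = 0 := by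
      rcases le_or_gt 0 (a x) with ha | ha
      · have h3 : α x = 0 := by rw [hα]; exact max_eq_left (by linarith)
        have h4 : β x = 0 := max_eq_left (by linarith)
        simp [h3, h4]
      · have hb' : b x = 0 := by
          rcases max_cases 0 (-a x - b x) with h3 | h3 <;> rw [hα, h3.1] at htα h1 <;> nlinarith
        have htβ : t * β x = 0 := by linarith
        have h4 : β x = -a x := max_eq_right (by linarith)
        have h5 : t = 0 := (mul_eq_zero.1 htβ).resolve_right (by linarith)
        simp [h5]
    have hx : (x : E) = 0 := by
      simpa [G, hzero.1, hzero.2] using h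
    have := norm_eq_of_mem_sphere x
    rw [hx, norm_zero] at this
    exact zero_ne_one this
  obtain ⟨F, hF, hFG⟩ := exists_continuous_normalize G hGc hG0
  refine ⟨F, hF, fun x => Subtype.ext ?_, fun t => Subtype.ext ?_, fun x hx => ?_⟩ <;> rw [hFG]
  · have : G (0, x) = x := by simp [G]
    rw [this, norm_eq_of_mem_sphere x, inv_one, one_smul]
  · have : G (t, x₀) = x₀ := by simp [G, α, β, ha0, hb0]
    rw [this, hx₀, inv_one, one_smul]
  · rw [real_inner_smul_left, hGa]
    refine mul_nonneg (inv_nonneg.2 (norm_nonneg _)) ?_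
    have h1 : -a x - max (b x) 0 ≤ α x := le_max_right _ _
    rw [max_eq_right (show b x ≤ 0 from hx)] at h1
    simp only [Set.Icc.coe_one]
    linarith

/-- The diagonal of a sphere of positive dimension deforms, relative to the basepoint, into
`X ∨ X ⊆ X × X`. -/
theorem exists_deformation_diagonal (x₀ : sphere (0 : E) 1) (h : 2 ≤ Module.finrank ℝ E) :
    ∃ f g : I × sphere (0 : E) 1 → sphere (0 : E) 1, Continuous f ∧ Continuous g ∧
      (∀ x, f (0, x) = x) ∧ (∀ x, g (0, x) = x) ∧
      (∀ t, f (t, x₀) = x₀) ∧ (∀ t, g (t, x₀) = x₀) ∧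
      ∀ x, f (1, x) = x₀ ∨ g (1, x) = x₀ := by
  have hx₀ : (x₀ : E) ≠ 0 := ne_zero_of_mem_unit_sphere x₀
  obtain ⟨v, hv, hvx⟩ : ∃ v : E, ‖v‖ = 1 ∧ inner ℝ v (x₀ : E) = 0 := by
    have : Module.Finite ℝ E := Module.finite_of_finrank_pos (by omega)
    have hne : (ℝ ∙ (x₀ : E))ᗮ ≠ ⊥ := by
      intro hbot
      have h1 := Submodule.finrank_add_finrank_orthogonal (ℝ ∙ (x₀ : E))
      rw [hbot, finrank_bot, finrank_span_singleton hx₀] at h1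
      omega
    obtain ⟨w, hw, hw0⟩ := Submodule.exists_mem_ne_zero_of_ne_bot hne
    refine ⟨‖w‖⁻¹ • w, ?_, ?_⟩
    · rw [norm_smul, norm_inv, norm_norm, inv_mul_cancel₀ (norm_ne_zero_iff.2 hw0)]
    · rw [real_inner_smul_left, Submodule.mem_orthogonal_singleton_iff_inner_left.1 hw, mul_zero]
  obtain ⟨p, hp, hp0, hpx, hp1⟩ := exists_collapse_hemisphere x₀
  obtain ⟨q, hq, hq0, hqx, hq1⟩ := exists_push_hemisphere x₀ v hv hvx
  obtain ⟨r, hr, hr0, hrx, hr1⟩ := exists_push_hemisphere x₀ (-v) (by rwa [norm_neg])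
    (by rw [inner_neg_left, hvx, neg_zero])
  refine ⟨fun y => p (y.1, q y), fun y => p (y.1, r y), by fun_prop, by fun_prop, ?_, ?_, ?_, ?_,
    fun x => ?_⟩
  · simp [hp0, hq0]
  · simp [hp0, hr0]
  · simp [hpx, hqx]
  · simp [hpx, hrx]
  · rcases le_total (inner ℝ (x : E) v) 0 with hx | hx
    · exact Or.inl (hp1 _ (hq1 x hx))
    · exact Or.inr (hp1 _ (hr1 x (by rwa [inner_neg_right, neg_nonpos])))

end Sphere

end LabelledConf

end

theorem proposition2p3 {M : Type*} [TopologicalSpace M] (l : ℕ) (hl : 1 ≤ l)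
    (x₀ : Metric.sphere (0 : EuclideanSpace ℝ (Fin (2 * l + 1))) 1) :
    ∃ (hΦ : Continuous (LabelledConf.Phi (∅ : Set M) x₀))
      (hΨ : Continuous (LabelledConf.Psi (∅ : Set M) x₀)),
      LabelledConf.Phi (∅ : Set M) x₀ (LabelledConf.V.base (∅ : Set M) x₀) = 0 ∧
      LabelledConf.Psi (∅ : Set M) x₀ (LabelledConf.V.base (∅ : Set M) x₀) = 0 ∧
      ContinuousMap.HomotopicRel
        (⟨LabelledConf.Phi (∅ : Set M) x₀, hΦ⟩ :
          C(LabelledConf.V (∅ : Set M) x₀, LabelledConf.SPVV (∅ : Set M) x₀))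
        (⟨LabelledConf.Psi (∅ : Set M) x₀, hΨ⟩ :
          C(LabelledConf.V (∅ : Set M) x₀, LabelledConf.SPVV (∅ : Set M) x₀))
        {LabelledConf.V.base (∅ : Set M) x₀} := by
  have h2 : 2 ≤ Module.finrank ℝ (EuclideanSpace ℝ (Fin (2 * l + 1))) := by
    rw [finrank_euclideanSpace_fin]
    omega
  obtain ⟨f, g, hf, hg, hf0, hg0, hfx, hgx, hfg⟩ :=
    LabelledConf.exists_deformation_diagonal x₀ h2
  obtain ⟨hΦ, hΨ, h⟩ := LabelledConf.exists_homotopicRel_Phi_Psi (∅ : Set M) x₀ hf hg hf0 hg0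
    hfx hgx hfg
  exact ⟨hΦ, hΨ, LabelledConf.Phi_base _ _, LabelledConf.Psi_base _ _, h⟩
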